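/- Let $\Phi$ be a (reduced) crystallographic root system in a finite-dimensional Euclidean space $V$, with simple system $S$ and positive system $\Phi^+$. For $\alpha\in\Phi$ and $r\in\mathbb R$ let $H_\alpha^r=\{x\in V\mid\langle x,\alpha\rangle=r\}$. The Catalan arrangement of $\Phi$ consists of the hyperplanes $H_\alpha^0$ and $H_\alpha^1$ for $\alpha\in\Phi$; its regions are the connected components of the complement of the union of these hyperplanes, and a region $R$ is dominant if $\langle x,\alpha\rangle>0$ for all $x\in R$ and $\alpha\in\Phi^+$. The walls of a dominant region $R$ are the hyperplanes that support a facet of $R$; a wall that does not contain the origin is a ceiling of $R$ if the origin lies on the same side of it as $R$, and a floor of $R$ if it separates $R$ from the origin. Put $CL(R)=\{\alpha\in\Phi^+\mid H_\alpha^1\text{ is a ceiling of }R\}$ and $FL(R)=\{\alpha\in\Phi^+\mid H_\alpha^1\text{ is a floor of }R\}$. Order $\Phi^+$ by $\alpha\le\beta$ if and only if $\beta-\alpha$ is a linear combination of simple roots with nonnegative integer coefficients (the root poset). An ideal is a subset $I\subseteq\Phi^+$ such that $\alpha\in I$ and $\beta\le\alpha$ imply $\beta\in I$. For a dominant region $R$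 let $\theta(R)=\{\alpha\in\Phi^+\mid\langle x,\alpha\rangle<1\text{ for all }x\in R\}$. For an ideal $I$ let $\mathbf{Pan}(I)$, the Panyushev complement, be the ideal generated by the minimal elements of $\Phi^+\setminus I$. Then $\theta$ is a bijection from the set of dominant regions of the Catalan arrangement to the set of ideals of the root poset, and $CL$ and $FL$ are bijections from the set of dominant regions to the set of antichains of the root poset. For every ideal $I$, the region $\theta^{-1}(\mathbf{Pan}(I))$ is the unique dominant region of the Catalan arrangement whose ceilings are exactly the floors of $\theta^{-1}(I)$. Moreover, $\mathbf{Pan}=\theta\circ CL^{-1}\circ FL\circ\theta^{-1}$. -/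

import Mathlib

open scoped InnerProductSpace

namespace Catalan

section Definitions

variable {ι V N : Type*} [NormedAddCommGroup V] [InnerProductSpace ℝ V]
  [AddCommGroup N] [Module ℝ N]

/-- The root pairing is realised in the Euclidean space `V`: the reflection attached to each root
`α` is the orthogonal reflection `x ↦ x - (2⟨x, α⟩ / ⟨α, α⟩) α`. -/
def IsEuclidean (P : RootPairing ι ℝ V N) : Prop :=
  ∀ (i : ι) (x : V),
    P.reflection i x = x - (2 * ⟪x, P.root i⟫_ℝ / ⟪P.root i, P.root i⟫_ℝ) • P.root i

/-- The affine subspace `H_α^r = {x ∈ V | ⟨x, α⟩ = r}`. -/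
def hyperplane (α : V) (r : ℝ) : AffineSubspace ℝ V where
  carrier := {x | ⟪x, α⟫_ℝ = r}
  smul_vsub_vadd_mem' := by
    intro c p₁ p₂ p₃ h₁ h₂ h₃
    simp only [Set.mem_ofPred_eq, vsub_eq_sub, vadd_eq_add, inner_add_left, inner_smul_left,
      inner_sub_left] at *
    rw [h₁, h₂, h₃]
    simp

/-- The `k`-Catalan arrangement: the hyperplanes `H_α^r` for `α ∈ Φ` and `r ∈ {0, 1, …, k}`. -/
def arrangement (P : RootPairing ι ℝ V N) (k : ℕ) : Set (AffineSubspace ℝ V) :=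
  {H | ∃ (i : ι) (r : ℕ), r ≤ k ∧ H = hyperplane (P.root i) r}

/-- The complement in `V` of the union of the hyperplanes of the `k`-Catalan arrangement. -/
def arrangementCompl (P : RootPairing ι ℝ V N) (k : ℕ) : Set V :=
  {x | ∀ H ∈ arrangement P k, x ∉ H}

/-- The regions: connected components of the complement of the `k`-Catalan arrangement. -/
def IsRegion (P : RootPairing ι ℝ V N) (k : ℕ) (R : Set V) : Prop :=
  ∃ x ∈ arrangementCompl P k, R = connectedComponentIn (arrangementCompl P k) x

variable {P : RootPairing ι ℝ V N}

/-- The (index type of the) set `Φ⁺` of positive roots with respect to the simple system `b`. -/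
def PosRoot (b : P.Base) : Type _ := {i : ι // b.IsPos i}

/-- The positive root, as a vector of `V`. -/
def PosRoot.vec {b : P.Base} (α : PosRoot b) : V := P.root α.1

/-- A vector and its negative can both be nonnegative integer combinations of the simple roots only
if the vector is zero. -/
theorem eq_zero_of_mem_closure (b : P.Base) {v : V}
    (h₁ : v ∈ AddSubmonoid.closure (P.root '' b.support))
    (h₂ : -v ∈ AddSubmonoid.closure (P.root '' b.support)) : v = 0 := by
  have hli := b.linearIndepOn_root
  obtain ⟨f, hf⟩ : ∃ f : V →ₗ[ℝ] ℝ, ∀ i ∈ b.support, f (P.root i) = 1 := by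
    let B := Module.Basis.span hli
    obtain ⟨f, hf⟩ := (B.constr ℝ (fun _ => (1 : ℝ))).exists_extend
    refine ⟨f, fun i hi => ?_⟩
    have h := LinearMap.congr_fun hf (B ⟨i, hi⟩)
    rw [Module.Basis.constr_basis, LinearMap.comp_apply, Submodule.subtype_apply] at h
    have hB : ((B ⟨i, hi⟩ : _) : V) = P.root i :=
      congrArg Subtype.val (Module.Basis.span_apply hli ⟨i, hi⟩)
    rwa [hB] at h
  have key : ∀ w ∈ AddSubmonoid.closure (P.root '' b.support), 0 ≤ f w ∧ (f w = 0 → w = 0) := by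
    intro w hw
    induction hw using AddSubmonoid.closure_induction with
    | mem x hx =>
      obtain ⟨i, hi, rfl⟩ := hx
      rw [hf i hi]
      exact ⟨zero_le_one, fun h => absurd h one_ne_zero⟩
    | zero => simp
    | add x y _ _ hx hy =>
      rw [map_add]
      refine ⟨add_nonneg hx.1 hy.1, fun h => ?_⟩
      rw [hx.2 (by linarith [hx.1, hy.1]), hy.2 (by linarith [hx.1, hy.1]), add_zero]
  have h₃ := (key _ h₂).1
  rw [map_neg] at h₃
  exact (key v h₁).2 (by linarith [(key v h₁).1])

/-- The root poset: `α ≤ β` if and only if `β - α` is a linear combination of simple roots with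
nonnegative integer coefficients. -/
instance instPartialOrderPosRoot (b : P.Base) : PartialOrder (PosRoot b) where
  le α β := β.vec - α.vec ∈ AddSubmonoid.closure (P.root '' b.support)
  le_refl α := by simp
  le_trans α β γ h₁ h₂ := by simpa using add_mem h₂ h₁
  le_antisymm α β h₁ h₂ := by
    have h := eq_zero_of_mem_closure b h₁ (by simpa using h₂)
    exact Subtype.ext (P.root.injective (sub_eq_zero.mp h)).symm

/-- A set `R` is dominant if `⟨x, α⟩ > 0` for all `α ∈ Φ⁺` and `x ∈ R`. -/
def IsDominant (b : P.Base) (R : Set V) : Prop :=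
  ∀ x ∈ R, ∀ α : PosRoot b, 0 < ⟪x, α.vec⟫_ℝ

/-- The dominant regions of the `k`-Catalan arrangement. -/
def DominantRegion (b : P.Base) (k : ℕ) : Type _ :=
  {R : Set V // IsRegion P k R ∧ IsDominant b R}

/-- The walls of a region `R`: the hyperplanes of the arrangement that support a facet of `R`,
that is, that meet the closure of `R` in a set whose affine span is the whole hyperplane. -/
def walls (P : RootPairing ι ℝ V N) (k : ℕ) (R : Set V) : Set (AffineSubspace ℝ V) :=
  {H | H ∈ arrangement P k ∧ affineSpan ℝ (closure R ∩ (H : Set V)) = H}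

/-- The ceilings of `R`: the walls that do not contain the origin and have the origin strictly on
the same side as `R`. -/
def ceilings {b : P.Base} {k : ℕ} (R : DominantRegion b k) : Set (AffineSubspace ℝ V) :=
  {H | H ∈ walls P k R.1 ∧ (0 : V) ∉ H ∧ ∀ x ∈ R.1, H.SSameSide 0 x}

/-- The floors of `R`: the walls that do not contain the origin and separate `R` from it. -/
def floors {b : P.Base} {k : ℕ} (R : DominantRegion b k) : Set (AffineSubspace ℝ V) :=
  {H | H ∈ walls P k R.1 ∧ (0 : V) ∉ H ∧ ∀ x ∈ R.1, H.SOppSide 0 x}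

/-- `CL(R)`: the positive roots `α` such that `H_α^1` is a ceiling of `R`. -/
def CL {b : P.Base} (R : DominantRegion b 1) : Set (PosRoot b) :=
  {α | hyperplane α.vec 1 ∈ ceilings R}

/-- `FL(R)`: the positive roots `α` such that `H_α^1` is a floor of `R`. -/
def FL {b : P.Base} (R : DominantRegion b 1) : Set (PosRoot b) :=
  {α | hyperplane α.vec 1 ∈ floors R}

/-- Inner products with a dominant vector are monotone on the root poset. -/
theorem inner_vec_mono {b : P.Base} {x : V} (hx : ∀ α : PosRoot b, 0 < ⟪x, α.vec⟫_ℝ)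
    {α β : PosRoot b} (h : α ≤ β) : ⟪x, α.vec⟫_ℝ ≤ ⟪x, β.vec⟫_ℝ := by
  have key : ∀ w ∈ AddSubmonoid.closure (P.root '' b.support), 0 ≤ ⟪x, w⟫_ℝ := by
    intro w hw
    induction hw using AddSubmonoid.closure_induction with
    | mem y hy =>
      obtain ⟨i, hi, rfl⟩ := hy
      exact (hx ⟨i, b.isPos_of_mem_support hi⟩).le
    | zero => simp
    | add y z _ _ hy hz =>
      rw [inner_add_right]
      exact add_nonneg hy hz
  have h' := key _ h
  rw [inner_sub_right] at h'
  linarith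

/-- The map `θ` for `k = 1`: it sends a dominant region `R` of the Catalan arrangement to the ideal
`{α ∈ Φ⁺ | ⟨x, α⟩ < 1 for all x ∈ R}` of the root poset. -/
def theta {b : P.Base} (R : DominantRegion b 1) : LowerSet (PosRoot b) where
  carrier := {α | ∀ x ∈ R.1, ⟪x, α.vec⟫_ℝ < 1}
  lower' := fun _ _ hle hα x hx => (inner_vec_mono (R.2.2 x hx) hle).trans_lt (hα x hx)

/-- The Panyushev complement of `I`: the ideal generated by the minimal elements of `Φ⁺ \ I`. -/
def Pan {b : P.Base} (I : LowerSet (PosRoot b)) : LowerSet (PosRoot b) :=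
  lowerClosure {α | Minimal (fun β => β ∉ I) α}

end Definitions

end Catalan

/-! A dominant region lies on one side of every hyperplane, so its ideal determines it: it is the
set `chamber I` cut out by the corresponding strict inequalities. The hard point is
`chamber_nonempty`: every ideal `I` occurs. If the inequalities had no solution, Gordan's
alternative would give a nontrivial nonnegative relation between roots. Since roots have integer
coordinates in the simple roots, the weights may be taken in `ℕ` (`exists_nat_weights`). This yields
an equality between a sum of roots outside `I` plus some positive roots and a sum of no more roots
of `I` than there are roots outside. `eq_zero_of_sum_add_sum_eq_sum` rules this out: two positive
roots at an acute angle are equal or differ by a positive root, so the equality can be shortened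
until nothing is left.

For walls, adding or removing one root `α` of an ideal gives another nonempty chamber, and a segment
between the two chambers crosses `H_α^1` in a facet. Conversely, monotonicity of inner products on
the root poset forces the root of a ceiling to be maximal in the ideal, and that of a floor to be
minimal outside it. Hence ceilings and floors are the two standard antichains of an ideal, and the
Panyushev complement turns the second into the first. -/

open scoped InnerProductSpace

namespace Catalan

/-! ### Gordan's alternative and integral weights -/

section LinearInequalities

/-- For finitely many reals there is a `ℚ`-linear map `ℝ → ℚ` that is positive on those that are
positive. -/
theorem exists_ratLinear_pos {J : Type*} [Finite J] (w : J → ℝ) :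
    ∃ φ : ℝ →ₗ[ℚ] ℚ, ∀ j, 0 < w j → 0 < φ (w j) := by
  let M := Submodule.span ℚ (Set.range w)
  have hfin : FiniteDimensional ℚ M := FiniteDimensional.span_of_finite ℚ (Set.finite_range w)
  let e := Module.finBasis ℚ M
  have hwM : ∀ j, w j ∈ M := fun j => Submodule.subset_span ⟨j, rfl⟩
  let r : J → Fin (Module.finrank ℚ M) → ℚ := fun j => e.repr ⟨w j, hwM j⟩
  have hr : ∀ j, ∑ k, (r j k : ℝ) * (e k : ℝ) = w j := by
    intro j
    have h := congrArg (Submodule.subtype M) (e.sum_repr ⟨w j, hwM j⟩)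
    rw [map_sum] at h
    simpa [r, Rat.smul_def] using h
  -- The coordinates of the `w j` in the `ℚ`-basis `e` are fixed, and the values on the basis may
  -- vary. Positivity of the positive `w j` is an open condition that holds at the real values `e
  -- k`, hence also at some rational values `q k`.
  let U : Set (Fin (Module.finrank ℚ M) → ℝ) :=
    ⋂ j, {q | 0 < w j → 0 < ∑ k, (r j k : ℝ) * q k}
  have hU : IsOpen U := by
    refine isOpen_iInter_of_finite fun j => ?_
    by_cases hj : 0 < w j
    · simp only [hj, true_imp_iff]
      exact isOpen_lt continuous_const (by fun_prop)
    · simp [hj]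
  have hne : U.Nonempty := ⟨fun k => (e k : ℝ), Set.mem_iInter.2 fun j hj => by rwa [hr]⟩
  have hd : DenseRange (Pi.map fun (_ : Fin (Module.finrank ℚ M)) (x : ℚ) => (x : ℝ)) :=
    DenseRange.piMap fun _ => Rat.denseRange_cast
  obtain ⟨q, hq⟩ := hd.exists_mem_open hU hne
  obtain ⟨φ, hφ⟩ := (e.constr ℚ q).exists_extend
  refine ⟨φ, fun j hj => ?_⟩
  have h := Set.mem_iInter.1 hq j hj
  have h' : φ (w j) = ∑ k, r j k * q k := by
    have h := LinearMap.congr_fun hφ ⟨w j, hwM j⟩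
    rw [LinearMap.comp_apply, Submodule.subtype_apply, Module.Basis.constr_apply_fintype] at h
    simpa [r] using h
  rw [h']
  have hcast : (0 : ℝ) < ((∑ k, r j k * q k : ℚ) : ℝ) := by simpa using h
  exact_mod_cast hcast

/-- Nonnegative real weights can be replaced by natural numbers, with no positive weight becoming
zero, so that all integral linear relations between them persist. -/
theorem exists_nat_weights {J : Type*} [Fintype J] (w : J → ℝ) (hw : ∀ j, 0 ≤ w j) :
    ∃ m : J → ℕ, (∀ j, 0 < w j → m j ≠ 0) ∧
      ∀ n : J → ℤ, ∑ j, w j * n j = 0 → ∑ j, (m j : ℤ) * n j = 0 := by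
  obtain ⟨φ, hφ⟩ := exists_ratLinear_pos w
  have hφ0 : ∀ j, 0 ≤ φ (w j) := fun j => by
    rcases (hw j).eq_or_lt with h | h
    · simp [← h]
    · exact (hφ j h).le
  -- A common denominator: each `φ (w j) * D` is a natural number, and these are the new weights.
  let D : ℕ := ∏ j, (φ (w j)).den
  have hD : (D : ℚ) ≠ 0 := by
    simp [D, Finset.prod_eq_zero_iff]
  have hm : ∀ j, ∃ m : ℕ, (m : ℚ) = φ (w j) * D := by
    intro j
    obtain ⟨c, hc⟩ : (φ (w j)).den ∣ D := Finset.dvd_prod_of_mem _ (Finset.mem_univ j)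
    refine ⟨(φ (w j)).num.toNat * c, ?_⟩
    have h1 : (((φ (w j)).num.toNat : ℤ) : ℚ) = (φ (w j)).num := by
      rw [Int.toNat_of_nonneg (Rat.num_nonneg.2 (hφ0 j))]
    rw [hc]
    push_cast at h1 ⊢
    rw [h1, ← mul_assoc, Rat.mul_den_eq_num]
  choose m hm using hm
  refine ⟨m, fun j hj h0 => ?_, fun n hn => ?_⟩
  · have := hm j
    rw [h0, Nat.cast_zero] at this
    exact (mul_ne_zero (hφ j hj).ne' hD) this.symm
  · have h : ∑ j, φ (w j) * n j = 0 := by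
      have := congrArg φ hn
      rw [map_sum, map_zero] at this
      rw [← this]
      refine Finset.sum_congr rfl fun j _ => ?_
      -- The map `φ` is only additive and `ℚ`-linear; the integer coefficient can still be taken
      -- out.
      have h2 : w j * n j = (n j) • w j := by rw [zsmul_eq_mul, mul_comm]
      rw [h2, map_zsmul, zsmul_eq_mul, mul_comm]
    have h3 : ((∑ j, (m j : ℤ) * n j : ℤ) : ℚ) = 0 := by
      push_cast
      simp_rw [hm]
      rw [← zero_mul (D : ℚ), ← h, Finset.sum_mul]
      exact Finset.sum_congr rfl fun j _ => by ring
    exact_mod_cast h3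

/-- Gordan's alternative: finitely many vectors lie in an open half-space, or they satisfy a
nontrivial linear relation with nonnegative coefficients. -/
theorem exists_pos_or_exists_weights {J E : Type*} [Fintype J] [NormedAddCommGroup E]
    [NormedSpace ℝ E] (v : J → E) :
    (∃ f : E →L[ℝ] ℝ, ∀ j, 0 < f (v j)) ∨
      ∃ w : J → ℝ, (∀ j, 0 ≤ w j) ∧ ∑ j, w j = 1 ∧ ∑ j, w j • v j = 0 := by
  classical
  by_cases h0 : (0 : E) ∈ convexHull ℝ (Set.range v)
  · right
    rw [convexHull_range_eq_exists_affineCombination] at h0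
    obtain ⟨s, w, hw, hs, h⟩ := h0
    rw [s.affineCombination_eq_linear_combination v w hs] at h
    refine ⟨fun j => if j ∈ s then w j else 0, fun j => ?_, ?_, ?_⟩
    · dsimp only
      split_ifs with hj
      exacts [hw j hj, le_rfl]
    · simpa using hs
    · simpa [ite_smul] using h
  · left
    obtain ⟨f, u, hu, hf⟩ := geometric_hahn_banach_point_closed (convex_convexHull ℝ _)
      ((Set.finite_range v).isClosed_convexHull ℝ) h0
    rw [map_zero] at hu
    exact ⟨f, fun j => hu.trans (hf _ (subset_convexHull ℝ _ ⟨j, rfl⟩))⟩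

end LinearInequalities

/-! ### Positive roots and relations between them -/

section Roots

variable {ι V N : Type*} [NormedAddCommGroup V] [InnerProductSpace ℝ V]
  [AddCommGroup N] [Module ℝ N] {P : RootPairing ι ℝ V N} {b : P.Base}

instance [Finite ι] : Finite (PosRoot b) := Subtype.finite

theorem PosRoot.vec_ne_zero (α : PosRoot b) : α.vec ≠ 0 := P.ne_zero α.1

theorem PosRoot.vec_injective : Function.Injective (PosRoot.vec : PosRoot b → V) :=
  fun _ _ h => Subtype.ext (P.root.injective h)

theorem PosRoot.le_iff {α β : PosRoot b} :
    α ≤ β ↔ β.vec - α.vec ∈ AddSubmonoid.closure (P.root '' b.support) := Iff.rfl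

theorem PosRoot.vec_mem_closure (α : PosRoot b) :
    α.vec ∈ AddSubmonoid.closure (P.root '' b.support) := by
  obtain ⟨f, -, h, hf⟩ := b.exists_root_eq_sum_int α.1
  have hpos : ∀ j, 0 ≤ f j := by
    rcases h with h | h
    · exact fun j => h.le j
    · have h1 : 0 < b.height α.1 := α.2
      rw [RootPairing.Base.height_eq_sum hf] at h1
      exact absurd (Finset.sum_nonpos fun j _ => h.le j) (not_le.2 h1)
  rw [PosRoot.vec, hf]
  refine sum_mem fun j hj => ?_
  rw [← Int.toNat_of_nonneg (hpos j), natCast_zsmul]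
  exact nsmul_mem (AddSubmonoid.subset_closure (Set.mem_image_of_mem _ hj)) _

theorem PosRoot.exists_vec_eq (i : ι) :
    ∃ α : PosRoot b, α.vec = P.root i ∨ α.vec = -P.root i := by
  let := P.indexNeg
  rcases RootPairing.Base.IsPos.or_neg b i with h | h
  · exact ⟨⟨i, h⟩, Or.inl rfl⟩
  · exact ⟨⟨-i, h⟩, Or.inr (by simp [PosRoot.vec])⟩

theorem multiset_sum_vec_mem_closure (A : Multiset (PosRoot b)) :
    (A.map PosRoot.vec).sum ∈ AddSubmonoid.closure (P.root '' b.support) := by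
  refine multiset_sum_mem _ fun v hv => ?_
  obtain ⟨α, -, rfl⟩ := Multiset.mem_map.1 hv
  exact α.vec_mem_closure

/-- If `α` occurs in the sum, then `-α` is the sum of the remaining roots, so `α` and `-α` are both
nonnegative combinations of simple roots. -/
theorem eq_zero_of_multiset_sum_vec_eq_zero {A : Multiset (PosRoot b)}
    (h : (A.map PosRoot.vec).sum = 0) : A = 0 := by
  induction A using Multiset.induction_on with
  | empty => rfl
  | cons α A _ =>
    rw [Multiset.map_cons, Multiset.sum_cons] at h
    refine absurd (eq_zero_of_mem_closure b α.vec_mem_closure ?_) α.vec_ne_zero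
    rw [neg_eq_of_add_eq_zero_right h]
    exact multiset_sum_vec_mem_closure A

/-- The reflection formula identifies the Cartan integers with the inner products. -/
theorem pairing_eq_inner (hP : IsEuclidean P) (i j : ι) :
    P.pairing i j = 2 * ⟪P.root i, P.root j⟫_ℝ / ⟪P.root j, P.root j⟫_ℝ := by
  have h := hP j (P.root i)
  rw [RootPairing.reflection_apply_root, sub_right_inj] at h
  exact smul_left_injective ℝ (P.ne_zero j) h

theorem exists_inner_pos_of_multiset {x : V} {A : Multiset (PosRoot b)}
    (h : 0 < ⟪(A.map PosRoot.vec).sum, x⟫_ℝ) : ∃ α ∈ A, 0 < ⟪α.vec, x⟫_ℝ := by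
  by_contra! hc
  refine absurd h (not_lt.2 ?_)
  induction A using Multiset.induction_on with
  | empty => simp
  | cons α A ih =>
    rw [Multiset.map_cons, Multiset.sum_cons, inner_add_left] at h ⊢
    have h1 := hc α (Multiset.mem_cons_self α A)
    have h2 := ih (by linarith) fun β hβ => hc β (Multiset.mem_cons_of_mem hβ)
    linarith

variable [Finite ι] [P.IsCrystallographic]

/-- Two positive roots with an acute angle are equal or differ by a positive root. -/
theorem PosRoot.eq_or_exists_sub (hP : IsEuclidean P) {α β : PosRoot b}
    (h : 0 < ⟪α.vec, β.vec⟫_ℝ) :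
    α = β ∨ (∃ δ : PosRoot b, α.vec = β.vec + δ.vec) ∨ ∃ δ : PosRoot b, β.vec = α.vec + δ.vec := by
  by_cases hne : α = β
  · exact Or.inl hne
  right
  have hpair : 0 < P.pairingIn ℤ α.1 β.1 := by
    have h1 : (0 : ℝ) < P.pairing α.1 β.1 := by
      rw [pairing_eq_inner hP]
      have := real_inner_self_pos.2 β.vec_ne_zero
      exact div_pos (mul_pos two_pos h) this
    rw [← P.algebraMap_pairingIn ℤ] at h1
    simpa using h1
  obtain ⟨k, hk⟩ := P.root_sub_root_mem_of_pairingIn_pos hpair fun h => hne (Subtype.ext h)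
  obtain ⟨δ, hδ | hδ⟩ := PosRoot.exists_vec_eq (b := b) k
  · exact Or.inl ⟨δ, by rw [hδ, hk]; simp [PosRoot.vec]⟩
  · exact Or.inr ⟨δ, by rw [hδ, hk]; simp [PosRoot.vec]⟩

/-- A sum of roots outside an ideal, and further positive roots, is never a sum of at most as many
roots of the ideal. -/
theorem eq_zero_of_sum_add_sum_eq_sum (hP : IsEuclidean P) (I : LowerSet (PosRoot b))
    (A B C : Multiset (PosRoot b)) (hA : ∀ α ∈ A, α ∉ I) (hB : ∀ β ∈ B, β ∈ I)
    (hcard : B.card ≤ A.card)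
    (hsum : (A.map PosRoot.vec).sum + (C.map PosRoot.vec).sum = (B.map PosRoot.vec).sum) :
    A = 0 ∧ C = 0 := by
  -- Induction on the length of the relation; each case below shortens it by one or two terms or
  -- contradicts the ideal property.
  induction hn : A.card + B.card + C.card using Nat.strong_induction_on generalizing A B C with
  | _ n ih =>
  by_cases hB0 : (B.map PosRoot.vec).sum = 0
  · rw [hB0, ← Multiset.sum_add, ← Multiset.map_add] at hsum
    exact add_eq_zero.1 (eq_zero_of_multiset_sum_vec_eq_zero hsum)
  exfalso
  have hpos := real_inner_self_pos.2 hB0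
  obtain ⟨β, hβ, hβpos⟩ := exists_inner_pos_of_multiset hpos
  obtain ⟨B, rfl⟩ := Multiset.exists_cons_of_mem hβ
  have hβI := hB β hβ
  have hB' : ∀ γ ∈ B, γ ∈ I := fun γ hγ => hB γ (Multiset.mem_cons_of_mem hγ)
  -- The root `β` has positive inner product with the common value of both sides, hence with a
  -- single term `α` on the left.
  rw [real_inner_comm, ← hsum, ← Multiset.sum_add, ← Multiset.map_add] at hβpos
  obtain ⟨α, hα, hαpos⟩ := exists_inner_pos_of_multiset hβpos
  rw [Multiset.card_cons] at hcard hn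
  rw [Multiset.map_cons, Multiset.sum_cons] at hsum
  rcases Multiset.mem_add.1 hα with hα | hα
  · obtain ⟨A, rfl⟩ := Multiset.exists_cons_of_mem hα
    have hαI := hA α hα
    have hA' : ∀ γ ∈ A, γ ∉ I := fun γ hγ => hA γ (Multiset.mem_cons_of_mem hγ)
    rw [Multiset.map_cons, Multiset.sum_cons] at hsum
    rw [Multiset.card_cons] at hcard hn
    rcases PosRoot.eq_or_exists_sub hP hαpos with rfl | ⟨δ, hδ⟩ | ⟨δ, hδ⟩
    · exact hαI hβI
    -- Here `α = β + δ`: cancel `β` and move `δ` to `C`. The counts of `A` and `B` both drop by one,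
    -- and the induction hypothesis says that a multiset containing `δ` is empty.
    · have := (ih _ (by rw [Multiset.card_cons]; omega) A B (δ ::ₘ C) hA' hB' (by omega) (by
        rw [Multiset.map_cons, Multiset.sum_cons]
        rw [hδ] at hsum
        rw [← add_right_inj β.vec, ← hsum]
        abel) rfl).2
      exact Multiset.cons_ne_zero this
    · refine hαI (I.lower ?_ hβI)
      rw [PosRoot.le_iff, hδ, add_sub_cancel_left]
      exact δ.vec_mem_closure
  · obtain ⟨C, rfl⟩ := Multiset.exists_cons_of_mem hα
    rw [Multiset.map_cons, Multiset.sum_cons] at hsum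
    rw [Multiset.card_cons] at hn
    -- When `α` comes from `C`, the multiset `A` is unchanged, and it is nonempty because `B`
    -- contained `β`. So a shorter relation with the same `A` suffices for a contradiction.
    have hA0 : A ≠ 0 := by
      rintro rfl
      simp at hcard
    rcases PosRoot.eq_or_exists_sub hP hαpos with rfl | ⟨δ, hδ⟩ | ⟨δ, hδ⟩
    · exact hA0 (ih _ (by omega) A B C hA hB' (by omega) (by
        rw [← add_right_inj α.vec, ← hsum]
        abel) rfl).1
    · exact hA0 (ih _ (by rw [Multiset.card_cons]; omega) A B (δ ::ₘ C) hA hB' (by omega) (by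
        rw [Multiset.map_cons, Multiset.sum_cons]
        rw [hδ] at hsum
        rw [← add_right_inj β.vec, ← hsum]
        abel) rfl).1
    -- Here `β = α + δ`, so `δ ≤ β` may replace `β` in `B` while `α` leaves `C`.
    · have hδI : δ ∈ I := by
        refine I.lower ?_ hβI
        rw [PosRoot.le_iff, hδ, add_sub_cancel_right]
        exact α.vec_mem_closure
      refine hA0 (ih _ ?_ A (δ ::ₘ B) C hA ?_ ?_ ?_ rfl).1
      · rw [Multiset.card_cons]; omega
      · intro γ hγ
        rcases Multiset.mem_cons.1 hγ with rfl | hγ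
        exacts [hδI, hB' γ hγ]
      · rwa [Multiset.card_cons]
      · rw [Multiset.map_cons, Multiset.sum_cons]
        rw [hδ, add_assoc] at hsum
        rw [← add_right_inj α.vec, ← hsum]
        abel

end Roots

/-! ### Every ideal has a nonempty chamber -/

section Chambers

theorem multiset_card_sum_replicate {X : Type*} (s : Finset X) (m : X → ℕ) :
    (∑ a ∈ s, Multiset.replicate (m a) a).card = ∑ a ∈ s, m a := by
  simp

theorem multiset_sum_map_sum_replicate {X E : Type*} [AddCommMonoid E] (s : Finset X) (m : X → ℕ)
    (f : X → E) :
    ((∑ a ∈ s, Multiset.replicate (m a) a).map f).sum = ∑ a ∈ s, m a • f a := by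
  classical
  induction s using Finset.induction_on with
  | empty => simp
  | insert a s ha ih => simp [Finset.sum_insert ha, ih]

variable {ι V N : Type*} [NormedAddCommGroup V] [InnerProductSpace ℝ V]
  [AddCommGroup N] [Module ℝ N] {P : RootPairing ι ℝ V N} {b : P.Base}

/-- Linear relations between vectors of the root lattice pass from real weights to natural weights
that satisfy the same integral relations. -/
theorem sum_nsmul_eq_zero_of_sum_smul_eq_zero (b : P.Base) {J : Type*} [Fintype J] {w : J → ℝ}
    {m : J → ℕ} (hm : ∀ n : J → ℤ, ∑ j, w j * n j = 0 → ∑ j, (m j : ℤ) * n j = 0) {u : J → V}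
    (hu : ∀ j, u j ∈ Submodule.span ℤ (P.root '' b.support)) (h : ∑ j, w j • u j = 0) :
    ∑ j, m j • u j = 0 := by
  have hn : ∀ j, ∃ n : b.support → ℤ, ∑ i, n i • P.root i = u j := fun j =>
    Submodule.mem_span_image_finset_iff_exists_fun ℤ |>.1 (hu j)
  choose n hn using hn
  -- Independence of the simple roots over `ℝ` splits the vector relation into one integral relation
  -- on the weights for each simple root.
  have h1 : ∑ i : b.support, (∑ j, w j * n j i) • P.root i = 0 := by
    rw [← h]
    simp_rw [← hn, Finset.smul_sum, Finset.sum_smul]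
    rw [Finset.sum_comm]
    refine Finset.sum_congr rfl fun j _ => Finset.sum_congr rfl fun i _ => ?_
    rw [mul_smul, Int.cast_smul_eq_zsmul]
  have h2 := Fintype.linearIndependent_iff.1 b.linearIndepOn_root _ h1
  simp_rw [← hn, Finset.smul_sum]
  rw [Finset.sum_comm]
  refine Finset.sum_eq_zero fun i _ => ?_
  have h3 := hm (fun j => n j i) (h2 i)
  simp_rw [← natCast_zsmul, ← mul_smul]
  rw [← Finset.sum_smul, h3, zero_smul]

/-- The dominant points that lie below the hyperplanes `H_α^1` with `α ∈ I`, and above the other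
ones. -/
def chamber (I : LowerSet (PosRoot b)) : Set V :=
  {x | (∀ α : PosRoot b, 0 < ⟪x, α.vec⟫_ℝ) ∧ (∀ α ∈ I, ⟪x, α.vec⟫_ℝ < 1) ∧
    ∀ α : PosRoot b, α ∉ I → 1 < ⟪x, α.vec⟫_ℝ}

variable [FiniteDimensional ℝ V] [Finite ι] [P.IsCrystallographic]

theorem chamber_nonempty (hP : IsEuclidean P) (I : LowerSet (PosRoot b)) :
    (chamber I).Nonempty := by
  classical
  have := FiniteDimensional.complete ℝ V
  have := Fintype.ofFinite (PosRoot b)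
  -- The system is homogenised with an unknown pair `(x, t)`: `none` encodes `t > 0`, `inl α`
  -- encodes `σ α * (⟪x, α⟫ - t) > 0`, and `inr α` encodes `⟪x, α⟫ > 0`. A solution yields the point
  -- `t⁻¹ • x`.
  let σ : PosRoot b → ℤ := fun α => if α ∈ I then -1 else 1
  let u : Option (PosRoot b ⊕ PosRoot b) → V
    | none => 0
    | some (.inl α) => σ α • α.vec
    | some (.inr α) => α.vec
  let n : Option (PosRoot b ⊕ PosRoot b) → ℤ
    | none => 1
    | some (.inl α) => -σ α
    | some (.inr _) => 0
  rcases exists_pos_or_exists_weights (fun j => (u j, (n j : ℝ))) with ⟨f, hf⟩ | ⟨w, hw, hw1, hwv⟩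
  · let t := f (0, 1)
    have ht : 0 < t := by simpa [u, n] using hf none
    let x := (InnerProductSpace.toDual ℝ V).symm (f.comp (ContinuousLinearMap.inl ℝ V ℝ))
    have hx : ∀ (v : V) (r : ℝ), f (v, r) = ⟪x, v⟫_ℝ + r * t := by
      intro v r
      have h1 : ((v, r) : V × ℝ) = (v, 0) + r • (0, 1) := by simp
      rw [h1, map_add, map_smul, InnerProductSpace.toDual_symm_apply]
      simp [t]
    have h1 : ∀ α : PosRoot b, ⟪t⁻¹ • x, α.vec⟫_ℝ = ⟪x, α.vec⟫_ℝ / t := fun α => by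
      rw [real_inner_smul_left]; ring
    refine ⟨t⁻¹ • x, fun α => ?_, fun α hα => ?_, fun α hα => ?_⟩ <;> rw [h1]
    · have h := hf (some (.inr α))
      simp only [u, n, hx, Int.cast_zero, zero_mul, add_zero] at h
      positivity
    · have h := hf (some (.inl α))
      simp only [u, n, σ, hx, hα, if_true] at h
      rw [div_lt_one ht]
      simp only [Int.reduceNeg, neg_smul, one_smul, inner_neg_right, neg_neg, Int.cast_one,
        one_mul] at h
      linarith
    · have h := hf (some (.inl α))
      simp only [u, n, σ, hx, hα, if_false] at h
      rw [one_lt_div ht]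
      simp only [Int.reduceNeg, one_smul, Int.cast_neg, Int.cast_one, neg_mul, one_mul] at h
      linarith
  -- In the other alternative, the `V`-component of the relation becomes `ΣA + ΣC = ΣB`, and the
  -- `ℝ`-component becomes `|A| = |B| + m none`.
  exfalso
  have hwv1 : ∑ j, w j • u j = 0 := by simpa [Prod.fst_sum] using congrArg Prod.fst hwv
  have hwv2 : ∑ j, w j * n j = 0 := by simpa [Prod.snd_sum] using congrArg Prod.snd hwv
  obtain ⟨m, hm0, hm⟩ := exists_nat_weights w hw
  have hu : ∀ j, u j ∈ Submodule.span ℤ (P.root '' b.support) := by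
    have h : ∀ α : PosRoot b, α.vec ∈ Submodule.span ℤ (P.root '' b.support) := fun α =>
      b.root_mem_span_int α.1
    rintro (_ | α | α)
    exacts [zero_mem _, zsmul_mem (h α) _, h α]
  have hV := sum_nsmul_eq_zero_of_sum_smul_eq_zero b hm hu hwv1
  have hZ := hm n hwv2
  rw [Fintype.sum_option, Fintype.sum_sum_type] at hV hZ
  simp only [u, n, σ, smul_zero, zero_add, mul_one, mul_zero, Finset.sum_const_zero, add_zero]
    at hV hZ
  rw [← Finset.sum_filter_add_sum_filter_not Finset.univ (· ∈ I)] at hV hZ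
  let A := ∑ α with α ∉ I, Multiset.replicate (m (some (.inl α))) α
  let B := ∑ α with α ∈ I, Multiset.replicate (m (some (.inl α))) α
  let C := ∑ α, Multiset.replicate (m (some (.inr α))) α
  have hcard : A.card = B.card + m none := by
    simp only [A, B, multiset_card_sum_replicate]
    zify
    have h1 : ∑ α with α ∈ I, (m (some (.inl α)) : ℤ) * -(if α ∈ I then -1 else 1) =
        ∑ α with α ∈ I, (m (some (.inl α)) : ℤ) :=
      Finset.sum_congr rfl fun α hα => by simp [(Finset.mem_filter.1 hα).2]
    have h2 : ∑ α with α ∉ I, (m (some (.inl α)) : ℤ) * -(if α ∈ I then -1 else 1) =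
        -∑ α with α ∉ I, (m (some (.inl α)) : ℤ) := by
      rw [← Finset.sum_neg_distrib]
      exact Finset.sum_congr rfl fun α hα => by simp [(Finset.mem_filter.1 hα).2]
    rw [h1, h2] at hZ
    linarith
  have hsum : (A.map PosRoot.vec).sum + (C.map PosRoot.vec).sum = (B.map PosRoot.vec).sum := by
    simp only [A, B, C, multiset_sum_map_sum_replicate]
    have h1 : ∑ α with α ∈ I, m (some (.inl α)) • (if α ∈ I then (-1 : ℤ) else 1) • α.vec =
        -∑ α with α ∈ I, m (some (.inl α)) • α.vec := by
      rw [← Finset.sum_neg_distrib]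
      exact Finset.sum_congr rfl fun α hα => by simp [(Finset.mem_filter.1 hα).2]
    have h2 : ∑ α with α ∉ I, m (some (.inl α)) • (if α ∈ I then (-1 : ℤ) else 1) • α.vec =
        ∑ α with α ∉ I, m (some (.inl α)) • α.vec :=
      Finset.sum_congr rfl fun α hα => by simp [(Finset.mem_filter.1 hα).2]
    rw [h1, h2, add_assoc, neg_add_eq_zero] at hV
    exact hV.symm
  obtain ⟨hA0, hC0⟩ := eq_zero_of_sum_add_sum_eq_sum hP I A B C
    (fun α hα => by
      obtain ⟨γ, hγ, h⟩ := Multiset.mem_sum.1 hα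
      rw [Multiset.eq_of_mem_replicate h]
      exact (Finset.mem_filter.1 hγ).2)
    (fun α hα => by
      obtain ⟨γ, hγ, h⟩ := Multiset.mem_sum.1 hα
      rw [Multiset.eq_of_mem_replicate h]
      exact (Finset.mem_filter.1 hγ).2) (by omega) hsum
  have hcardA : A.card = 0 := by rw [hA0, Multiset.card_zero]
  have hcardB : B.card = 0 := by omega
  have hcardC : C.card = 0 := by rw [hC0, Multiset.card_zero]
  have hnone : m none = 0 := by omega
  simp only [A, B, C, multiset_card_sum_replicate, Finset.sum_eq_zero_iff, Finset.mem_filter,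
    Finset.mem_univ, true_and, true_imp_iff] at hcardA hcardB hcardC
  -- A positive real weight would have a nonzero integral counterpart, so all real weights vanish
  -- although they sum to `1`.
  have hw0 : ∀ j, w j = 0 := by
    intro j
    refine ((hw j).eq_or_lt.resolve_right fun h => hm0 j h ?_).symm
    rcases j with _ | α | α
    · exact hnone
    · by_cases hα : α ∈ I
      exacts [hcardB α hα, hcardA α hα]
    · exact hcardC α
  simp [hw0] at hw1

end Chambers

/-! ### Dominant regions are chambers of ideals -/

section Regions

variable {ι V N : Type*} [NormedAddCommGroup V] [InnerProductSpace ℝ V]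
  [AddCommGroup N] [Module ℝ N] {P : RootPairing ι ℝ V N} {b : P.Base}

theorem mem_hyperplane {α x : V} {r : ℝ} : x ∈ hyperplane α r ↔ ⟪x, α⟫_ℝ = r := Iff.rfl

theorem mem_arrangementCompl_one {x : V} :
    x ∈ arrangementCompl P 1 ↔ ∀ i, ⟪x, P.root i⟫_ℝ ≠ 0 ∧ ⟪x, P.root i⟫_ℝ ≠ 1 := by
  constructor
  · intro h i
    refine ⟨fun h0 => h _ ⟨i, 0, by norm_num, rfl⟩ ?_, fun h1 => h _ ⟨i, 1, le_rfl, rfl⟩ ?_⟩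
    · simpa [mem_hyperplane] using h0
    · simpa [mem_hyperplane] using h1
  · rintro h _ ⟨i, r, hr, rfl⟩ hx
    rw [mem_hyperplane] at hx
    interval_cases r
    · exact (h i).1 (by simpa using hx)
    · exact (h i).2 (by simpa using hx)

theorem chamber_subset_arrangementCompl (I : LowerSet (PosRoot b)) :
    chamber I ⊆ arrangementCompl P 1 := by
  intro x hx
  rw [mem_arrangementCompl_one]
  intro i
  obtain ⟨α, hα | hα⟩ := PosRoot.exists_vec_eq (b := b) i
  · rw [← hα]
    refine ⟨(hx.1 α).ne', ?_⟩
    by_cases hI : α ∈ I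
    exacts [(hx.2.1 α hI).ne, (hx.2.2 α hI).ne']
  · rw [← neg_eq_iff_eq_neg.2 hα, inner_neg_right]
    have := hx.1 α
    constructor <;> linarith

theorem chamber_eq_iInter (I : LowerSet (PosRoot b)) :
    chamber I = (⋂ α : PosRoot b, {x | 0 < ⟪x, α.vec⟫_ℝ}) ∩
      ((⋂ α : PosRoot b, ⋂ _ : α ∈ I, {x | ⟪x, α.vec⟫_ℝ < 1}) ∩
        ⋂ α : PosRoot b, ⋂ _ : α ∉ I, {x | 1 < ⟪x, α.vec⟫_ℝ}) := by
  ext x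
  simp [chamber]

theorem convex_chamber (I : LowerSet (PosRoot b)) : Convex ℝ (chamber I) := by
  have hlin : ∀ v : V, IsLinearMap ℝ fun x => ⟪x, v⟫_ℝ := fun v =>
    ⟨fun x y => inner_add_left x y v, fun c x => real_inner_smul_left x v c⟩
  rw [chamber_eq_iInter]
  refine (convex_iInter fun α => convex_halfSpace_gt (hlin _) _).inter
    ((convex_iInter₂ fun α _ => convex_halfSpace_lt (hlin _) _).inter
      (convex_iInter₂ fun α _ => convex_halfSpace_gt (hlin _) _))

theorem inner_lt_of_isPreconnected {S : Set V} (hS : IsPreconnected S) {v : V} {r : ℝ}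
    (h : ∀ x ∈ S, ⟪x, v⟫_ℝ ≠ r) {x y : V} (hx : x ∈ S) (hy : y ∈ S) (hlt : ⟪x, v⟫_ℝ < r) :
    ⟪y, v⟫_ℝ < r := by
  by_contra! hle
  obtain ⟨z, hz, hzr⟩ := hS.intermediate_value hx hy
    (f := fun z => ⟪z, v⟫_ℝ) (by fun_prop) ⟨hlt.le, hle⟩
  exact h z hz hzr

/-- A preconnected subset of the complement of the arrangement that meets a chamber is contained
in it. -/
theorem subset_chamber_of_isPreconnected {S : Set V} (hS : IsPreconnected S)
    (hc : S ⊆ arrangementCompl P 1) {I : LowerSet (PosRoot b)} {x : V} (hx : x ∈ S)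
    (hxI : x ∈ chamber I) : S ⊆ chamber I := by
  have h0 : ∀ α : PosRoot b, ∀ y ∈ S, ⟪y, α.vec⟫_ℝ ≠ 0 := fun α y hy =>
    (mem_arrangementCompl_one.1 (hc hy) α.1).1
  have h1 : ∀ α : PosRoot b, ∀ y ∈ S, ⟪y, α.vec⟫_ℝ ≠ 1 := fun α y hy =>
    (mem_arrangementCompl_one.1 (hc hy) α.1).2
  intro y hy
  refine ⟨fun α => ?_, fun α hα => ?_, fun α hα => ?_⟩
  · refine (h0 α y hy).lt_or_gt.resolve_left fun h => ?_
    exact (hxI.1 α).not_gt (inner_lt_of_isPreconnected hS (h0 α) hy hx h)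
  · exact inner_lt_of_isPreconnected hS (h1 α) hx hy (hxI.2.1 α hα)
  · refine (h1 α y hy).lt_or_gt.resolve_left fun h => ?_
    exact (hxI.2.2 α hα).not_gt (inner_lt_of_isPreconnected hS (h1 α) hy hx h)

theorem connectedComponentIn_eq_chamber {I : LowerSet (PosRoot b)} {x : V} (hx : x ∈ chamber I) :
    connectedComponentIn (arrangementCompl P 1) x = chamber I := by
  refine Set.Subset.antisymm ?_ ?_
  · exact subset_chamber_of_isPreconnected isPreconnected_connectedComponentIn
      (connectedComponentIn_subset _ _)
      (mem_connectedComponentIn (chamber_subset_arrangementCompl I hx)) hx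
  · exact (convex_chamber I).isPreconnected.subset_connectedComponentIn hx
      (chamber_subset_arrangementCompl I)

/-- Connectedness keeps the region on one side of each `H_α^1`, so a root not in `theta R` exceeds
`1` on all of it. -/
theorem DominantRegion.eq_chamber (R : DominantRegion b 1) : R.1 = chamber (theta R) := by
  obtain ⟨x, hx, hR⟩ := R.2.1
  have hxR : x ∈ R.1 := hR ▸ mem_connectedComponentIn hx
  have hpre : IsPreconnected R.1 := hR ▸ isPreconnected_connectedComponentIn
  have hsub : R.1 ⊆ arrangementCompl P 1 := hR ▸ connectedComponentIn_subset _ _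
  have h1 : ∀ α : PosRoot b, ∀ y ∈ R.1, ⟪y, α.vec⟫_ℝ ≠ 1 := fun α y hy =>
    (mem_arrangementCompl_one.1 (hsub hy) α.1).2
  have hxc : x ∈ chamber (theta R) := by
    refine ⟨R.2.2 x hxR, fun α hα => hα x hxR, fun α hα => ?_⟩
    refine (h1 α x hxR).lt_or_gt.resolve_left fun h => hα ?_
    exact fun y hy => inner_lt_of_isPreconnected hpre (h1 α) hxR hy h
  exact hR.trans (connectedComponentIn_eq_chamber hxc)

theorem DominantRegion.nonempty (R : DominantRegion b 1) : R.1.Nonempty := by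
  obtain ⟨x, hx, hR⟩ := R.2.1
  exact ⟨x, hR ▸ mem_connectedComponentIn hx⟩

theorem theta_injective : Function.Injective (theta : DominantRegion b 1 → _) := fun R R' h =>
  Subtype.ext (by rw [R.eq_chamber, R'.eq_chamber, h])

variable [FiniteDimensional ℝ V] [Finite ι] [P.IsCrystallographic]

theorem theta_surjective (hP : IsEuclidean P) :
    Function.Surjective (theta : DominantRegion b 1 → _) := by
  intro I
  obtain ⟨x, hx⟩ := chamber_nonempty hP I
  refine ⟨⟨chamber I, ⟨x, chamber_subset_arrangementCompl I hx,
    (connectedComponentIn_eq_chamber hx).symm⟩, fun y hy => hy.1⟩, ?_⟩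
  ext α
  refine ⟨fun h => ?_, fun hα y hy => hy.2.1 α hα⟩
  by_contra hα
  exact (h x hx).not_gt (hx.2.2 α hα)

end Regions

/-! ### Walls, ceilings and floors -/

section Walls

variable {ι V N : Type*} [NormedAddCommGroup V] [InnerProductSpace ℝ V]
  [AddCommGroup N] [Module ℝ N] {P : RootPairing ι ℝ V N} {b : P.Base}

theorem zero_notMem_hyperplane_one (v : V) : (0 : V) ∉ hyperplane v 1 := by
  simp [mem_hyperplane]

theorem inv_smul_mem_hyperplane_one {v : V} (hv : v ≠ 0) :
    (⟪v, v⟫_ℝ)⁻¹ • v ∈ hyperplane v 1 := by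
  rw [mem_hyperplane, real_inner_smul_left]
  exact inv_mul_cancel₀ (inner_self_ne_zero.2 hv)

theorem sub_smul_mem_hyperplane_one {v : V} (hv : v ≠ 0) (x : V) :
    x - (⟪x, v⟫_ℝ - 1) • (⟪v, v⟫_ℝ)⁻¹ • v ∈ hyperplane v 1 := by
  have h := inv_smul_mem_hyperplane_one hv
  rw [mem_hyperplane] at h ⊢
  rw [inner_sub_left, real_inner_smul_left, h]
  ring

theorem sSameSide_hyperplane_one_iff {v : V} (hv : v ≠ 0) (x : V) :
    (hyperplane v 1).SSameSide 0 x ↔ ⟪x, v⟫_ℝ < 1 := by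
  constructor
  · rintro ⟨⟨p, hp, q, hq, h⟩, -, hx⟩
    rw [mem_hyperplane] at hp hq hx
    -- Pairing with `v` sends the two vectors on a common ray to the reals `-1` and `⟪x, v⟫ - 1`, so
    -- the latter is not positive.
    have h1 := h.map (innerₛₗ ℝ v)
    simp only [innerₛₗ_apply_apply, vsub_eq_sub, inner_sub_right, inner_zero_right] at h1
    rw [real_inner_comm] at hp hq hx
    rw [real_inner_comm]
    rw [hp, hq] at h1
    obtain ⟨r, hr, h2⟩ := h1.exists_nonneg_left (by norm_num)
    rw [smul_eq_mul] at h2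
    exact lt_of_le_of_ne (by linarith) hx
  · intro hx
    refine ⟨⟨_, inv_smul_mem_hyperplane_one hv, _, sub_smul_mem_hyperplane_one hv x, ?_⟩,
      zero_notMem_hyperplane_one v, fun h => hx.ne h⟩
    have h : x -ᵥ (x - (⟪x, v⟫_ℝ - 1) • (⟪v, v⟫_ℝ)⁻¹ • v) =
        (1 - ⟪x, v⟫_ℝ) • ((0 : V) -ᵥ (⟪v, v⟫_ℝ)⁻¹ • v) := by
      simp only [vsub_eq_sub]
      module
    rw [h]
    exact SameRay.sameRay_nonneg_smul_right _ (by linarith)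

theorem sOppSide_hyperplane_one_iff {v : V} (hv : v ≠ 0) (x : V) :
    (hyperplane v 1).SOppSide 0 x ↔ 1 < ⟪x, v⟫_ℝ := by
  constructor
  · rintro ⟨⟨p, hp, q, hq, h⟩, -, hx⟩
    rw [mem_hyperplane] at hp hq hx
    have h1 := h.map (innerₛₗ ℝ v)
    simp only [innerₛₗ_apply_apply, vsub_eq_sub, inner_sub_right, inner_zero_right] at h1
    rw [real_inner_comm] at hp hq hx
    rw [real_inner_comm]
    rw [hp, hq] at h1
    obtain ⟨r, hr, h2⟩ := h1.exists_nonneg_left (by norm_num)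
    rw [smul_eq_mul] at h2
    exact lt_of_le_of_ne (by linarith) (Ne.symm hx)
  · intro hx
    refine ⟨⟨_, inv_smul_mem_hyperplane_one hv, _, sub_smul_mem_hyperplane_one hv x, ?_⟩,
      zero_notMem_hyperplane_one v, fun h => hx.ne' h⟩
    have h : (x - (⟪x, v⟫_ℝ - 1) • (⟪v, v⟫_ℝ)⁻¹ • v) -ᵥ x =
        (⟪x, v⟫_ℝ - 1) • ((0 : V) -ᵥ (⟪v, v⟫_ℝ)⁻¹ • v) := by
      simp only [vsub_eq_sub]
      module
    rw [h]
    exact SameRay.sameRay_nonneg_smul_right _ (by linarith)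

/-- Let `p` be the foot of the perpendicular from the origin to `H_v^1`. As `p` lies in `H_w^1`, the
difference `u = w - v` is orthogonal to `v`. Then `p + u` is also in both hyperplanes, so `u` is
orthogonal to `w`, and hence to itself. -/
theorem eq_of_hyperplane_one_le {v w : V} (hv : v ≠ 0) (h : hyperplane v 1 ≤ hyperplane w 1) :
    v = w := by
  have hp := inv_smul_mem_hyperplane_one hv
  set p := (⟪v, v⟫_ℝ)⁻¹ • v with hpdef
  have hpw : ⟪p, w⟫_ℝ = 1 := h hp
  let u := w - v
  have hpv : ⟪p, v⟫_ℝ = 1 := hp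
  have hvw : ⟪v, w⟫_ℝ = ⟪v, v⟫_ℝ := by
    rw [hpdef, real_inner_smul_left, inv_mul_eq_one₀ (inner_self_ne_zero.2 hv)] at hpw
    exact hpw.symm
  have huv : ⟪u, v⟫_ℝ = 0 := by
    rw [inner_sub_left, real_inner_comm, hvw, sub_self]
  have hmem : p + u ∈ hyperplane v 1 := by
    rw [mem_hyperplane, inner_add_left, hpv, huv, add_zero]
  have huw : ⟪u, w⟫_ℝ = 0 := by
    have := mem_hyperplane.1 (h hmem)
    rw [inner_add_left, hpw] at this
    linarith
  have huu : ⟪u, u⟫_ℝ = 0 := by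
    rw [show ⟪u, u⟫_ℝ = ⟪u, w⟫_ℝ - ⟪u, v⟫_ℝ from inner_sub_right _ _ _, huv, huw, sub_self]
  exact (sub_eq_zero.1 (inner_self_eq_zero.1 huu)).symm

/-- The facet spans `H_α^1`, so `H_β^1` contains all of `H_α^1` once it contains the facet. -/
theorem eq_of_wall {α β : PosRoot b} {R : Set V} (h : hyperplane α.vec 1 ∈ walls P 1 R)
    (hβ : ∀ y ∈ closure R, ⟪y, α.vec⟫_ℝ = 1 → ⟪y, β.vec⟫_ℝ = 1) : α = β := by
  refine PosRoot.vec_injective (eq_of_hyperplane_one_le α.vec_ne_zero ?_)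
  rw [← h.2, affineSpan_le]
  exact fun y hy => hβ y hy.1 hy.2

/-- Any point of the hyperplane lies on the line through `z` and a second point of the hyperplane
close enough to `z` to lie in `U`. -/
theorem affineSpan_inter_hyperplane {S U : Set V} {v z : V} {r : ℝ} (hU : IsOpen U) (hzU : z ∈ U)
    (hz : z ∈ hyperplane v r) (hS : ∀ y ∈ U, y ∈ hyperplane v r → y ∈ S) :
    affineSpan ℝ (S ∩ (hyperplane v r : Set V)) = hyperplane v r := by
  refine le_antisymm (affineSpan_le.2 Set.inter_subset_right) fun p hp => ?_
  have hcont : Continuous fun t : ℝ => AffineMap.lineMap z p t := AffineMap.lineMap_continuous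
  have hev : ∀ᶠ t : ℝ in nhds 0, AffineMap.lineMap z p t ∈ U := by
    refine hcont.continuousAt.eventually_mem (hU.mem_nhds ?_)
    simpa using hzU
  obtain ⟨t, htU, ht⟩ : ∃ t : ℝ, AffineMap.lineMap z p t ∈ U ∧ 0 < t :=
    ((hev.filter_mono nhdsWithin_le_nhds).and
      (eventually_mem_nhdsWithin (s := Set.Ioi (0 : ℝ)))).exists
  have hzS : z ∈ affineSpan ℝ (S ∩ (hyperplane v r : Set V)) :=
    subset_affineSpan _ _ ⟨hS z hzU hz, hz⟩
  have htH : AffineMap.lineMap z p t ∈ hyperplane v r := AffineMap.lineMap_mem t hz hp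
  have hqS : AffineMap.lineMap z p t ∈ affineSpan ℝ (S ∩ (hyperplane v r : Set V)) :=
    subset_affineSpan _ _ ⟨hS _ htU htH, htH⟩
  have hp' : p = AffineMap.lineMap z (AffineMap.lineMap z p t : V) t⁻¹ := by
    simp [AffineMap.lineMap_apply, smul_smul, inv_mul_cancel₀ ht.ne']
  rw [hp']
  exact AffineMap.lineMap_mem _ hzS hqS

/-- The conditions that define a chamber, except for the position relative to `H_α^1`. -/
def relaxedChamber (I : LowerSet (PosRoot b)) (α : PosRoot b) : Set V :=
  {x | ∀ β : PosRoot b, 0 < ⟪x, β.vec⟫_ℝ ∧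
    (β ≠ α → (β ∈ I → ⟪x, β.vec⟫_ℝ < 1) ∧ (β ∉ I → 1 < ⟪x, β.vec⟫_ℝ))}

theorem relaxedChamber_eq_iInter (I : LowerSet (PosRoot b)) (α : PosRoot b) :
    relaxedChamber I α = ⋂ β : PosRoot b, ({x | 0 < ⟪x, β.vec⟫_ℝ} ∩
      ⋂ _ : β ≠ α, ((⋂ _ : β ∈ I, {x | ⟪x, β.vec⟫_ℝ < 1}) ∩
        ⋂ _ : β ∉ I, {x | 1 < ⟪x, β.vec⟫_ℝ})) := by
  ext x
  simp only [relaxedChamber, Set.mem_ofPred_eq, Set.mem_iInter, Set.mem_inter_iff]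

theorem convex_relaxedChamber (I : LowerSet (PosRoot b)) (α : PosRoot b) :
    Convex ℝ (relaxedChamber I α) := by
  have hlin : ∀ v : V, IsLinearMap ℝ fun x => ⟪x, v⟫_ℝ := fun v =>
    ⟨fun x y => inner_add_left x y v, fun c x => real_inner_smul_left x v c⟩
  rw [relaxedChamber_eq_iInter]
  exact convex_iInter fun β => (convex_halfSpace_gt (hlin _) _).inter <| convex_iInter fun _ =>
    (convex_iInter fun _ => convex_halfSpace_lt (hlin _) _).inter
      (convex_iInter fun _ => convex_halfSpace_gt (hlin _) _)

theorem isOpen_relaxedChamber [Finite ι] (I : LowerSet (PosRoot b)) (α : PosRoot b) :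
    IsOpen (relaxedChamber I α) := by
  rw [relaxedChamber_eq_iInter]
  refine isOpen_iInter_of_finite fun β => (isOpen_lt (by fun_prop) (by fun_prop)).inter <|
    isOpen_iInter_of_finite fun _ => ?_
  exact (isOpen_iInter_of_finite fun _ => isOpen_lt (by fun_prop) (by fun_prop)).inter
    (isOpen_iInter_of_finite fun _ => isOpen_lt (by fun_prop) (by fun_prop))

theorem mem_chamber_iff {I : LowerSet (PosRoot b)} (α : PosRoot b) {x : V} :
    x ∈ chamber I ↔ x ∈ relaxedChamber I α ∧ (α ∈ I → ⟪x, α.vec⟫_ℝ < 1) ∧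
      (α ∉ I → 1 < ⟪x, α.vec⟫_ℝ) := by
  constructor
  · intro h
    exact ⟨fun β => ⟨h.1 β, fun _ => ⟨h.2.1 β, h.2.2 β⟩⟩, h.2.1 α, h.2.2 α⟩
  · rintro ⟨h, h1, h2⟩
    refine ⟨fun β => (h β).1, fun β hβ => ?_, fun β hβ => ?_⟩
    · by_cases hβα : β = α
      · subst hβα; exact h1 hβ
      · exact ((h β).2 hβα).1 hβ
    · by_cases hβα : β = α
      · subst hβα; exact h2 hβ
      · exact ((h β).2 hβα).2 hβ

/-- If two ideals differ in a single root `α`, then `H_α^1` is a wall of their chambers. -/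
theorem hyperplane_mem_walls [Finite ι] {I I' : LowerSet (PosRoot b)} {α : PosRoot b}
    (h : ∀ β, β ≠ α → (β ∈ I ↔ β ∈ I')) (hα : α ∈ I ↔ α ∉ I') (hI : (chamber I).Nonempty)
    (hI' : (chamber I').Nonempty) : hyperplane α.vec 1 ∈ walls P 1 (chamber I) := by
  refine ⟨⟨α.1, 1, le_rfl, by rw [Nat.cast_one]; rfl⟩, ?_⟩
  obtain ⟨x, hx⟩ := hI
  obtain ⟨y, hy⟩ := hI'
  obtain ⟨hxU, hx1, hx2⟩ := (mem_chamber_iff α).1 hx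
  obtain ⟨hyU, hy1, hy2⟩ := (mem_chamber_iff α).1 hy
  have hyU' : y ∈ relaxedChamber I α := fun β =>
    ⟨(hyU β).1, fun hβ => by rw [h β hβ]; exact (hyU β).2 hβ⟩
  -- The two chambers lie on opposite sides of `H_α^1` inside the same convex relaxed chamber, so a
  -- segment between them crosses the hyperplane there.
  obtain ⟨z, hz, hzα⟩ : ∃ z ∈ segment ℝ x y, ⟪z, α.vec⟫_ℝ = 1 := by
    have hpre := (convex_segment (𝕜 := ℝ) x y).isPreconnected
    have hc : ContinuousOn (fun z => ⟪z, α.vec⟫_ℝ) (segment ℝ x y) := by fun_prop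
    by_cases hαI : α ∈ I
    · exact hpre.intermediate_value (left_mem_segment ℝ x y) (right_mem_segment ℝ x y) hc
        ⟨(hx1 hαI).le, (hy2 (hα.1 hαI)).le⟩
    · exact hpre.intermediate_value (right_mem_segment ℝ x y) (left_mem_segment ℝ x y) hc
        ⟨(hy1 (by tauto)).le, (hx2 hαI).le⟩
  have hzU := (convex_relaxedChamber I α).segment_subset hxU hyU' hz
  refine affineSpan_inter_hyperplane (isOpen_relaxedChamber I α) hzU hzα fun p hpU hp => ?_
  rw [mem_hyperplane] at hp
  -- Moving from `p` towards `x` leaves the hyperplane on the side of `x`, so `p` is a limit of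
  -- points of the chamber.
  have hsub : openSegment ℝ p x ⊆ chamber I := by
    intro q hq
    rw [mem_chamber_iff α]
    refine ⟨(convex_relaxedChamber I α).openSegment_subset hpU hxU hq, ?_⟩
    obtain ⟨s, t, hs, ht, hst, rfl⟩ := hq
    rw [inner_add_left, real_inner_smul_left, real_inner_smul_left, hp]
    refine ⟨fun hαI => ?_, fun hαI => ?_⟩
    · nlinarith [hx1 hαI]
    · nlinarith [hx2 hαI]
  have hp' : p ∈ closure (openSegment ℝ p x) := by
    rw [closure_openSegment]
    exact left_mem_segment ℝ p x
  exact closure_mono hsub hp'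

theorem DominantRegion.le_on_closure (R : DominantRegion b 1) {α β : PosRoot b} (h : α ≤ β)
    {y : V} (hy : y ∈ closure R.1) : ⟪y, α.vec⟫_ℝ ≤ ⟪y, β.vec⟫_ℝ := by
  have hcl : IsClosed {y : V | ⟪y, α.vec⟫_ℝ ≤ ⟪y, β.vec⟫_ℝ} :=
    isClosed_le (by fun_prop) (by fun_prop)
  exact closure_minimal (fun x hx => inner_vec_mono (R.2.2 x hx) h) hcl hy

theorem DominantRegion.le_one_on_closure (R : DominantRegion b 1) {α : PosRoot b}
    (h : α ∈ theta R) {y : V} (hy : y ∈ closure R.1) : ⟪y, α.vec⟫_ℝ ≤ 1 := by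
  have hcl : IsClosed {y : V | ⟪y, α.vec⟫_ℝ ≤ 1} := isClosed_le (by fun_prop) (by fun_prop)
  exact closure_minimal (fun x hx => (h x hx).le) hcl hy

theorem DominantRegion.one_le_on_closure (R : DominantRegion b 1) {α : PosRoot b}
    (h : α ∉ theta R) {y : V} (hy : y ∈ closure R.1) : 1 ≤ ⟪y, α.vec⟫_ℝ := by
  have hcl : IsClosed {y : V | 1 ≤ ⟪y, α.vec⟫_ℝ} := isClosed_le (by fun_prop) (by fun_prop)
  refine closure_minimal (fun x hx => ?_) hcl hy
  rw [R.eq_chamber] at hx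
  exact (hx.2.2 α h).le

theorem mem_CL_iff {R : DominantRegion b 1} {α : PosRoot b} :
    α ∈ CL R ↔ hyperplane α.vec 1 ∈ walls P 1 R.1 ∧ α ∈ theta R :=
  and_congr_right fun _ => ⟨
    fun h x hx => (sSameSide_hyperplane_one_iff α.vec_ne_zero x).1 (h.2 x hx),
    fun h => ⟨zero_notMem_hyperplane_one _, fun x hx =>
      (sSameSide_hyperplane_one_iff α.vec_ne_zero x).2 (h x hx)⟩⟩

theorem mem_FL_iff {R : DominantRegion b 1} {α : PosRoot b} :
    α ∈ FL R ↔ hyperplane α.vec 1 ∈ walls P 1 R.1 ∧ α ∉ theta R := by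
  refine and_congr_right fun _ => ⟨fun h hα => ?_, fun h => ⟨zero_notMem_hyperplane_one _,
    fun x hx => (sOppSide_hyperplane_one_iff α.vec_ne_zero x).2 ?_⟩⟩
  · obtain ⟨x, hx⟩ := R.nonempty
    exact (hα x hx).not_gt ((sOppSide_hyperplane_one_iff α.vec_ne_zero x).1 (h.2 x hx))
  · rw [R.eq_chamber] at hx
    exact hx.2.2 α h

/-- A wall that does not contain the origin is `H_α^1` for a positive root `α`. -/
theorem exists_eq_hyperplane_one_of_wall (R : DominantRegion b 1) {H : AffineSubspace ℝ V}
    (hH : H ∈ walls P 1 R.1) (h0 : (0 : V) ∉ H) : ∃ α : PosRoot b, H = hyperplane α.vec 1 := by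
  obtain ⟨⟨i, r, hr, rfl⟩, hspan⟩ := hH
  interval_cases r
  · simp [mem_hyperplane] at h0
  rw [Nat.cast_one] at hspan ⊢
  obtain ⟨α, hα | hα⟩ := PosRoot.exists_vec_eq (b := b) i
  · exact ⟨α, by rw [hα]⟩
  exfalso
  -- If the root is negative, its inner products with the closure of a dominant region are at most
  -- `0` and never reach `1`.
  have hempty : closure R.1 ∩ (hyperplane (P.root i) 1 : Set V) = ∅ := by
    refine Set.eq_empty_of_forall_notMem fun y hy => ?_
    have h1 : ⟪y, P.root i⟫_ℝ = 1 := hy.2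
    have hcl : IsClosed {y : V | 0 ≤ ⟪y, α.vec⟫_ℝ} := isClosed_le (by fun_prop) (by fun_prop)
    have h2 : 0 ≤ ⟪y, α.vec⟫_ℝ := closure_minimal (fun x hx => (R.2.2 x hx α).le) hcl hy.1
    rw [hα, inner_neg_right, h1] at h2
    linarith
  rw [hempty, AffineSubspace.span_empty] at hspan
  have := inv_smul_mem_hyperplane_one (P.ne_zero i)
  rw [← hspan] at this
  exact AffineSubspace.notMem_bot ℝ V _ this

theorem ceilings_eq_image (R : DominantRegion b 1) :
    ceilings R = (fun α : PosRoot b => hyperplane α.vec 1) '' CL R := by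
  refine Set.Subset.antisymm (fun H hH => ?_) (Set.image_subset_iff.2 fun _ h => h)
  obtain ⟨α, rfl⟩ := exists_eq_hyperplane_one_of_wall R hH.1 hH.2.1
  exact ⟨α, hH, rfl⟩

theorem floors_eq_image (R : DominantRegion b 1) :
    floors R = (fun α : PosRoot b => hyperplane α.vec 1) '' FL R := by
  refine Set.Subset.antisymm (fun H hH => ?_) (Set.image_subset_iff.2 fun _ h => h)
  obtain ⟨α, rfl⟩ := exists_eq_hyperplane_one_of_wall R hH.1 hH.2.1
  exact ⟨α, hH, rfl⟩

variable [FiniteDimensional ℝ V] [Finite ι] [P.IsCrystallographic]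

/-- The ceilings of a dominant region correspond to the maximal elements of its ideal. -/
theorem CL_eq_maximal (hP : IsEuclidean P) (R : DominantRegion b 1) :
    CL R = {α | Maximal (· ∈ theta R) α} := by
  ext α
  rw [mem_CL_iff]
  constructor
  · rintro ⟨hw, hα⟩
    refine ⟨hα, fun β hβ hle => (eq_of_wall hw fun y hy hyα => ?_).ge⟩
    -- On the facet, `1 = ⟪y, α⟫ ≤ ⟪y, β⟫ ≤ 1`, so the facet lies in `H_β^1` too.
    have h1 := R.le_one_on_closure hβ hy
    have h2 := R.le_on_closure hle hy
    linarith
  · intro hα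
    refine ⟨?_, hα.1⟩
    -- Removing a maximal element leaves an ideal, whose chamber lies across `H_α^1`.
    let I' : LowerSet (PosRoot b) :=
      { carrier := {β | β ∈ theta R ∧ β ≠ α}
        lower' := fun β γ hle hβ => ⟨(theta R).lower hle hβ.1, fun h =>
          hβ.2 ((hα.2 hβ.1 (h ▸ hle)).antisymm (h ▸ hle))⟩ }
    have hI' : ∀ β, β ∈ I' ↔ β ∈ theta R ∧ β ≠ α := fun _ => Iff.rfl
    rw [R.eq_chamber]
    exact hyperplane_mem_walls (I' := I') (fun β hβ => by simp [hI', hβ])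
      (by simpa [hI'] using hα.1) (chamber_nonempty hP _) (chamber_nonempty hP _)

/-- The floors of a dominant region correspond to the minimal elements outside its ideal. -/
theorem FL_eq_minimal (hP : IsEuclidean P) (R : DominantRegion b 1) :
    FL R = {α | Minimal (· ∉ theta R) α} := by
  ext α
  rw [mem_FL_iff]
  constructor
  · rintro ⟨hw, hα⟩
    refine ⟨hα, fun β hβ hle => (eq_of_wall hw fun y hy hyα => ?_).le⟩
    have h1 := R.one_le_on_closure hβ hy
    have h2 := R.le_on_closure hle hy
    linarith
  · intro hα
    refine ⟨?_, hα.1⟩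
    -- Dually, adjoining a minimal element of the complement gives an ideal.
    let I' : LowerSet (PosRoot b) :=
      { carrier := {β | β ∈ theta R ∨ β = α}
        lower' := by
          rintro β γ hle (hβ | rfl)
          · exact Or.inl ((theta R).lower hle hβ)
          · by_cases hγ : γ ∈ theta R
            · exact Or.inl hγ
            · exact Or.inr (hle.antisymm (hα.2 hγ hle)) }
    have hI' : ∀ β, β ∈ I' ↔ β ∈ theta R ∨ β = α := fun _ => Iff.rfl
    rw [R.eq_chamber]
    exact hyperplane_mem_walls (I' := I') (fun β hβ => by simp [hI', hβ])
      (by simpa [hI'] using hα.1) (chamber_nonempty hP _) (chamber_nonempty hP _)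

end Walls

/-! ### Ideals and antichains of a finite poset -/

section Ideals

variable {X : Type*} [PartialOrder X]

theorem isAntichain_setOf_maximal (p : X → Prop) : IsAntichain (· ≤ ·) {x | Maximal p x} :=
  fun _ hx _ hy hne hle => hne (hx.eq_of_le hy.1 hle)

theorem isAntichain_setOf_minimal (p : X → Prop) : IsAntichain (· ≤ ·) {x | Minimal p x} :=
  fun _ hx _ hy hne hle => hne (hy.eq_of_le hx.1 hle)

theorem setOf_minimal_notMem_compl_upperClosure {A : Set X} (hA : IsAntichain (· ≤ ·) A) :
    {x | Minimal (· ∉ (upperClosure A).compl) x} = A := by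
  ext x
  simpa using hA.minimal_mem_upperClosure_iff_mem (x := x)

variable [Finite X]

/-- An ideal of a finite poset is generated by its maximal elements. -/
theorem lowerClosure_setOf_maximal (I : LowerSet X) : lowerClosure {x | Maximal (· ∈ I) x} = I := by
  ext x
  rw [SetLike.mem_coe, mem_lowerClosure]
  refine ⟨fun ⟨y, hy, hle⟩ => I.lower hle hy.1, fun hx => ?_⟩
  obtain ⟨y, hle, hy⟩ := (Set.toFinite {x | x ∈ I}).exists_le_maximal hx
  exact ⟨y, hy, hle⟩

/-- A filter of a finite poset is generated by its minimal elements. -/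
theorem mem_iff_forall_minimal_not_le (I : LowerSet X) (x : X) :
    x ∈ I ↔ ∀ y, Minimal (· ∉ I) y → ¬ y ≤ x := by
  refine ⟨fun hx y hy hle => hy.1 (I.lower hle hx), fun h => ?_⟩
  by_contra hx
  obtain ⟨y, hle, hy⟩ := (Set.toFinite {x | x ∉ I}).exists_le_minimal hx
  exact h y hy hle

/-- By finiteness, an ideal consists of the elements that lie above none of the minimal elements of
its complement. -/
theorem setOf_minimal_notMem_injective :
    Function.Injective fun I : LowerSet X => {x | Minimal (· ∉ I) x} := by
  intro I I' h
  ext x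
  have h' : ∀ y, Minimal (· ∉ I) y ↔ Minimal (· ∉ I') y := fun y => Set.ext_iff.1 h y
  rw [SetLike.mem_coe, SetLike.mem_coe, mem_iff_forall_minimal_not_le,
    mem_iff_forall_minimal_not_le I']
  simp_rw [h']

end Ideals

/-! ### Bijections with antichains and the Panyushev complement -/

section Bijections

variable {ι V N : Type*} [NormedAddCommGroup V] [InnerProductSpace ℝ V]
  [AddCommGroup N] [Module ℝ N] {P : RootPairing ι ℝ V N}

/-- No information is lost in passing to roots, since every ceiling or floor of a dominant region is
`H_α^1` for a positive root `α`. -/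
theorem ceilings_eq_floors_iff {b : P.Base} (R R' : DominantRegion b 1) :
    ceilings R = floors R' ↔ CL R = FL R' := by
  refine ⟨fun h => ?_, fun h => by rw [ceilings_eq_image, floors_eq_image, h]⟩
  ext α
  exact Set.ext_iff.1 h _

variable [FiniteDimensional ℝ V] [Finite ι] [P.IsCrystallographic]

/-- An ideal and the antichain of its maximal elements determine each other; the inverse is
`lowerClosure`. -/
theorem CL_bijective (hP : IsEuclidean P) (b : P.Base) :
    Function.Bijective fun R : DominantRegion b 1 =>
      (⟨CL R, CL_eq_maximal hP R ▸ isAntichain_setOf_maximal _⟩ :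
        {A : Set (PosRoot b) // IsAntichain (· ≤ ·) A}) := by
  constructor
  · intro R R' h
    have h' : CL R = CL R' := congrArg Subtype.val h
    rw [CL_eq_maximal hP, CL_eq_maximal hP] at h'
    apply theta_injective
    rw [← lowerClosure_setOf_maximal (theta R), h', lowerClosure_setOf_maximal]
  · rintro ⟨A, hA⟩
    obtain ⟨R, hR⟩ := theta_surjective hP (lowerClosure A)
    refine ⟨R, Subtype.ext ?_⟩
    ext α
    simp only [CL_eq_maximal hP, hR]
    exact hA.maximal_mem_lowerClosure_iff_mem

/-- The antichain `A` comes from the ideal complementary to the filter that `A` generates. -/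
theorem FL_bijective (hP : IsEuclidean P) (b : P.Base) :
    Function.Bijective fun R : DominantRegion b 1 =>
      (⟨FL R, FL_eq_minimal hP R ▸ isAntichain_setOf_minimal _⟩ :
        {A : Set (PosRoot b) // IsAntichain (· ≤ ·) A}) := by
  constructor
  · intro R R' h
    have h' : FL R = FL R' := congrArg Subtype.val h
    rw [FL_eq_minimal hP, FL_eq_minimal hP] at h'
    exact theta_injective (setOf_minimal_notMem_injective h')
  · rintro ⟨A, hA⟩
    obtain ⟨R, hR⟩ := theta_surjective hP (upperClosure A).compl
    refine ⟨R, Subtype.ext ?_⟩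
    simp only [FL_eq_minimal hP, hR]
    exact setOf_minimal_notMem_compl_upperClosure hA

/-- The regions of `I` and `Pan I` have matching floors and ceilings. -/
theorem CL_eq_FL_iff (hP : IsEuclidean P) {b : P.Base} (R R' : DominantRegion b 1) :
    CL R = FL R' ↔ theta R = Pan (theta R') := by
  rw [CL_eq_maximal hP, FL_eq_minimal hP, Pan]
  constructor
  · intro h
    rw [← h, lowerClosure_setOf_maximal]
  -- The floors of `R'` form an antichain, and an antichain is the set of maximal elements of the
  -- ideal it generates.
  · intro h
    ext α
    rw [h]
    exact (isAntichain_setOf_minimal _).maximal_mem_lowerClosure_iff_mem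

end Bijections

end Catalan

theorem mainTheorem6 {ι V N : Type*} [Finite ι]
    [NormedAddCommGroup V] [InnerProductSpace ℝ V] [FiniteDimensional ℝ V]
    [AddCommGroup N] [Module ℝ N]
    (P : RootPairing ι ℝ V N) [P.IsCrystallographic] [P.IsReduced]
    (hP : Catalan.IsEuclidean P) (b : P.Base) :
    ∃ (θ : Catalan.DominantRegion b 1 ≃ LowerSet (Catalan.PosRoot b))
      (cl fl : Catalan.DominantRegion b 1 ≃
        {A : Set (Catalan.PosRoot b) // IsAntichain (· ≤ ·) A}),
      (∀ R, θ R = Catalan.theta R) ∧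
      (∀ R, (cl R : Set (Catalan.PosRoot b)) = Catalan.CL R) ∧
      (∀ R, (fl R : Set (Catalan.PosRoot b)) = Catalan.FL R) ∧
      (∀ I : LowerSet (Catalan.PosRoot b),
        Catalan.ceilings (θ.symm (Catalan.Pan I)) = Catalan.floors (θ.symm I) ∧
        ∀ R : Catalan.DominantRegion b 1,
          Catalan.ceilings R = Catalan.floors (θ.symm I) → R = θ.symm (Catalan.Pan I)) ∧
      (Catalan.Pan : LowerSet (Catalan.PosRoot b) → LowerSet (Catalan.PosRoot b)) =
        θ ∘ cl.symm ∘ fl ∘ θ.symm := by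
  let θ := Equiv.ofBijective _
    (⟨Catalan.theta_injective, Catalan.theta_surjective hP⟩ :
      Function.Bijective (Catalan.theta : Catalan.DominantRegion b 1 → _))
  let cl := Equiv.ofBijective _ (Catalan.CL_bijective hP b)
  let fl := Equiv.ofBijective _ (Catalan.FL_bijective hP b)
  have hθ : ∀ I, Catalan.theta (θ.symm I) = I := θ.apply_symm_apply
  refine ⟨θ, cl, fl, fun _ => rfl, fun _ => rfl, fun _ => rfl, fun I => ⟨?_, fun R hR => ?_⟩, ?_⟩
  · rw [Catalan.ceilings_eq_floors_iff, Catalan.CL_eq_FL_iff hP, hθ, hθ]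
  · rw [Catalan.ceilings_eq_floors_iff, Catalan.CL_eq_FL_iff hP, hθ] at hR
    exact θ.eq_symm_apply.2 hR
  · funext I
    have h : Catalan.CL (cl.symm (fl (θ.symm I))) = Catalan.FL (θ.symm I) :=
      congrArg Subtype.val (cl.apply_symm_apply (fl (θ.symm I)))
    rw [Catalan.CL_eq_FL_iff hP, hθ] at h
    exact h.symm
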